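/- Call a set $M\subseteq\mathbb{R}$ \emph{picoscopic} if for every $\varepsilon\in(0,1)$ there is a sequence of intervals $(I_k)_{k\in\omega}$, $\omega=\{0,1,2,\ldots\}$, such that $M\subseteq\bigcup_{k\in\omega} I_k$ and $|I_k|\le\varepsilon^{(k+1)!}$ for all $k\in\omega$, where $|I|$ denotes the length of the interval $I$. \textbf{Theorem.} There are a picoscopic set $X\subseteq\mathbb{R}$ and a point $x\in\mathbb{R}$ such that $X\cup\{x\}$ is not picoscopic. -/

import Mathlib

/-- `M ⊆ ℝ` is `(fₙ)ₙ`-microscopic: for every `ε ∈ (0,1)` it is covered by a sequence of intervals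
`(I k)` with `|I k| ≤ f k ε`. An interval is an order-connected subset of `ℝ` (open, closed or
half-open, possibly empty or unbounded), and its length is its Lebesgue measure, which is `∞` for
unbounded intervals. -/
def IsMicroscopic (f : ℕ → ℝ → ℝ) (M : Set ℝ) : Prop :=
  ∀ ε ∈ Set.Ioo (0 : ℝ) 1, ∃ I : ℕ → Set ℝ,
    (∀ k, (I k).OrdConnected) ∧ M ⊆ ⋃ k, I k ∧
      ∀ k, MeasureTheory.volume (I k) ≤ ENNReal.ofReal (f k ε)

/-- `M ⊆ ℝ` is picoscopic: it is `(fₙ)ₙ`-microscopic for `fₙ(ε) = ε ^ (n + 1)!`. -/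
def IsPicoscopic (M : Set ℝ) : Prop :=
  IsMicroscopic (fun n ε => ε ^ (n + 1).factorial) M

/-! The set is an intersection of levels. Level `μ` is a union of intervals short enough for `ε = 2
^ (-(μ + 1))`, placed so that a cover at `ε = 1 / 2` cannot spare one member. A remote extra point
wastes a member.

Intervals of one level are so far apart (`separated`) that `J l` cannot hit two of them if one has
index at most `l` (`Hits.eq`). With a wasted member, pigeonhole gives every level an interval missed
by all sets up to its own index, roughly (`exists_unhit`). If unhit intervals always had unhit
children (`exists_unhit_child`), a nested branch would end in an uncovered point of the set. So
inside each unhit interval lies a filled one, whose child blocks almost all use up more than half of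
the sets with the same indices (`exists_filled`).

Two filled intervals with children at levels `μ ≠ μ'` share a block by the schedule, so some `J l`
hits children of both. With the second chosen inside an unhit interval of level `μ`, this `J l` hits
two intervals of level `μ`, contradicting separation. -/

namespace Picoscopic

/-! ### Offsets of children inside their parent -/

/-- Base-4 Cantor-type offsets in `[0, 1/2]`: the lowest `L` binary digits of `e`, followed by an
end marker. -/
noncomputable def off : ℕ → ℕ → ℝ
  | 0, _ => 1 / 2
  | L + 1, e => (((e % 2 : ℕ) : ℝ) + off L (e / 2)) / 4

theorem off_mem (L e : ℕ) : 0 ≤ off L e ∧ off L e ≤ 1 / 2 := by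
  induction L generalizing e with
  | zero => norm_num [off]
  | succ L ih =>
    obtain ⟨h0, h1⟩ := ih (e / 2)
    have h2 : ((e % 2 : ℕ) : ℝ) ≤ 1 := by
      exact_mod_cast Nat.le_of_lt_succ (Nat.mod_lt e two_pos)
    have h3 : (0 : ℝ) ≤ ((e % 2 : ℕ) : ℝ) := Nat.cast_nonneg _
    simp only [off]
    constructor <;> linarith

theorem off_succ_sub (L L' e e' : ℕ) (h : e % 2 = e' % 2) :
    off (L + 1) e - off (L' + 1) e' = (off L (e / 2) - off L' (e' / 2)) / 4 := by
  simp only [off, h]; ring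

theorem le_abs_off_succ_sub (L L' e e' : ℕ) (h : e % 2 ≠ e' % 2) :
    1 / 8 ≤ |off (L + 1) e - off (L' + 1) e'| := by
  obtain ⟨h0, h1⟩ := off_mem L (e / 2)
  obtain ⟨h2, h3⟩ := off_mem L' (e' / 2)
  simp only [off]
  rcases Nat.mod_two_eq_zero_or_one e with a | a <;>
    rcases Nat.mod_two_eq_zero_or_one e' with b | b
  · omega
  · rw [a, b, abs_sub_comm]; refine le_trans ?_ (le_abs_self _); push_cast; linarith
  · rw [a, b]; refine le_trans ?_ (le_abs_self _); push_cast; linarith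
  · omega

theorem mod_eq_of_abs_off_sub_lt (L s e e' : ℕ)
    (h : |off L e - off L e'| < 1 / (8 * 4 ^ s)) :
    e % 2 ^ min (s + 1) L = e' % 2 ^ min (s + 1) L := by
  induction L generalizing s e e' with
  | zero => simp [Nat.mod_one]
  | succ L ih =>
    have hs : (1 : ℝ) / (8 * 4 ^ s) ≤ 1 / 8 := by
      have : (1 : ℝ) ≤ 4 ^ s := one_le_pow₀ (by norm_num)
      apply one_div_le_one_div_of_le <;> linarith
    have hp : e % 2 = e' % 2 := by
      by_contra hne
      have := le_abs_off_succ_sub L L e e' hne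
      linarith
    rw [off_succ_sub L L e e' hp, abs_div] at h
    cases s with
    | zero => simpa using hp
    | succ s =>
      have h' : |off L (e / 2) - off L (e' / 2)| < 1 / (8 * 4 ^ s) := by
        have h4 : |(4 : ℝ)| = 4 := by norm_num
        have e1 : (1 : ℝ) / (8 * 4 ^ (s + 1)) = (1 / (8 * 4 ^ s)) / 4 := by
          rw [pow_succ]; field_simp
        rw [h4, e1] at h
        linarith
      have := ih s (e / 2) (e' / 2) h'
      rw [Nat.succ_min_succ, Nat.succ_eq_add_one, pow_succ', Nat.mod_mul, Nat.mod_mul, this, hp]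

/-- The end marker `1 / 2` is at distance at least `1 / 8` from every `(digit + tail) / 4`, which is
at most `3 / 8`. This keeps blocks of one parent apart. -/
theorem le_abs_off_sub {L L' : ℕ} (hL : L < L') (e e' : ℕ) :
    1 / (8 * 4 ^ L) ≤ |off L e - off L' e'| := by
  induction L generalizing L' e e' with
  | zero =>
    obtain ⟨M, rfl⟩ : ∃ M, L' = M + 1 := ⟨L' - 1, by omega⟩
    obtain ⟨h0, h1⟩ := off_mem M (e' / 2)
    have h2 : ((e' % 2 : ℕ) : ℝ) ≤ 1 := by
      exact_mod_cast Nat.le_of_lt_succ (Nat.mod_lt e' two_pos)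
    refine le_trans ?_ (le_abs_self _)
    simp only [off]
    norm_num
    linarith
  | succ L ih =>
    obtain ⟨M, rfl⟩ : ∃ M, L' = M + 1 := ⟨L' - 1, by omega⟩
    by_cases hp : e % 2 = e' % 2
    · rw [off_succ_sub L M e e' hp, abs_div]
      have := ih (L' := M) (by omega) (e / 2) (e' / 2)
      have h4 : |(4 : ℝ)| = 4 := by norm_num
      have e1 : (1 : ℝ) / (8 * 4 ^ (L + 1)) = (1 / (8 * 4 ^ L)) / 4 := by
        rw [pow_succ]; field_simp
      rw [h4, e1]
      linarith
    · refine le_trans ?_ (le_abs_off_succ_sub L M e e' hp)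
      have : (1 : ℝ) ≤ 4 ^ (L + 1) := one_le_pow₀ (by norm_num)
      apply one_div_le_one_div_of_le <;> linarith

theorem card_le_of_mod_eq {L t : ℕ} (ht : t ≤ L) (S : Finset ℕ) (hS : ∀ e ∈ S, e < 2 ^ L)
    (h : ∀ e ∈ S, ∀ e' ∈ S, e % 2 ^ t = e' % 2 ^ t) : S.card ≤ 2 ^ (L - t) := by
  rw [← Finset.card_range (2 ^ (L - t))]
  refine Finset.card_le_card_of_injOn (fun e => e / 2 ^ t) ?_ ?_
  · intro e he
    have := hS e he
    simp only [Finset.coe_range, Set.mem_Iio]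
    rw [Nat.div_lt_iff_lt_mul (by positivity), ← pow_add]
    rwa [Nat.sub_add_cancel ht]
  · intro e he e' he' heq
    have h1 := h e he e' he'
    simp only at heq
    rw [← Nat.div_add_mod e (2 ^ t), ← Nat.div_add_mod e' (2 ^ t), heq, h1]

/-! ### Lengths -/

/-- The length bound `ε ^ (k + 1)!` at `ε = 1 / 2`. -/
noncomputable def del (k : ℕ) : ℝ := (1 / 2) ^ (k + 1).factorial

/-- The floor `μ + 2` lets `(l + 1)!` outgrow `(μ + 1) * (kap μ k + 1)!` for all `l > kap μ k`. Its
price is that the first `μ + 3` intervals share a length; they will be roots. -/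
def kap (μ k : ℕ) : ℕ := max k (μ + 2)

/-- The length of the `k`-th interval of level `μ`. -/
noncomputable def len (μ k : ℕ) : ℝ := (1 / 2) ^ ((μ + 1) * (kap μ k + 1).factorial)

theorem half_pow_anti {m n : ℕ} (h : m ≤ n) : (1 / 2 : ℝ) ^ n ≤ (1 / 2) ^ m :=
  pow_le_pow_of_le_one (by norm_num) (by norm_num) h

theorem del_pos (k : ℕ) : 0 < del k := by unfold del; positivity

theorem len_pos (μ k : ℕ) : 0 < len μ k := by unfold len; positivity

theorem del_anti {k l : ℕ} (h : k ≤ l) : del l ≤ del k :=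
  half_pow_anti (Nat.factorial_le (by omega))

theorem del_le_half (k : ℕ) : del k ≤ 1 / 2 := by
  simpa [del] using del_anti (Nat.zero_le k)

theorem del_succ_le (k : ℕ) : del (k + 1) ≤ del k / 2 := by
  have h : (k + 1).factorial + 1 ≤ (k + 1 + 1).factorial := by
    rw [Nat.factorial_succ (k + 1)]
    nlinarith [Nat.factorial_pos (k + 1)]
  have := half_pow_anti h
  rw [pow_succ] at this
  unfold del
  linarith

theorem len_le_del (μ k : ℕ) : len μ k ≤ del k := by
  refine half_pow_anti ?_
  have h1 : (k + 1).factorial ≤ (kap μ k + 1).factorial :=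
    Nat.factorial_le (by unfold kap; omega)
  nlinarith [Nat.factorial_pos (kap μ k + 1)]

/-- The gap between children whose codes differ in the first `l + 3` digits is at least `len μ k /
(8 * 4 ^ (l + 2))`. The remaining factor `3` pays for one covering set and two intervals. -/
theorem mul_del_lt_len {μ k l : ℕ} (h : kap μ k < l) : 24 * 4 ^ (l + 2) * del l < len μ k := by
  have hμ : μ + 3 ≤ l := by unfold kap at h; omega
  have hf : (kap μ k + 1).factorial ≤ l.factorial := Nat.factorial_le h
  have hl : 2 * l ≤ l.factorial := by
    obtain ⟨n, rfl⟩ : ∃ n, l = n + 1 := ⟨l - 1, by omega⟩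
    have h2 : Nat.factorial 2 ≤ n.factorial := Nat.factorial_le (by omega)
    rw [Nat.factorial_succ]
    simp only [Nat.factorial_two] at h2
    nlinarith
  have hle : (μ + 1) * (kap μ k + 1).factorial + (2 * l + 9) ≤ (l + 1).factorial := by
    rw [Nat.factorial_succ l]
    have : (μ + 1) * (kap μ k + 1).factorial ≤ (μ + 1) * l.factorial := Nat.mul_le_mul_left _ hf
    nlinarith
  have h1 : del l ≤ len μ k * (1 / 2) ^ (2 * l + 9) := by
    have := half_pow_anti hle
    rwa [pow_add] at this
  have h2 : (4 : ℝ) ^ (l + 2) * (1 / 2) ^ (2 * l + 9) = 1 / 32 := by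
    rw [show (4 : ℝ) = 2 ^ 2 by norm_num, ← pow_mul,
      show 2 * l + 9 = 2 * (l + 2) + 5 by ring, pow_add, ← mul_assoc, ← mul_pow]
    norm_num
  have h3 : 24 * 4 ^ (l + 2) * del l ≤ 24 * 4 ^ (l + 2) * (len μ k * (1 / 2) ^ (2 * l + 9)) :=
    mul_le_mul_of_nonneg_left h1 (by positivity)
  have h4 : 24 * 4 ^ (l + 2) * (len μ k * (1 / 2) ^ (2 * l + 9)) = 24 / 32 * len μ k := by
    linear_combination 24 * len μ k * h2
  linarith [len_pos μ k]

/-! ### The forest of intervals -/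

/-- A schedule of codes: any two values at two distinct levels occur together infinitely often. -/
def sched (q μ : ℕ) : ℕ :=
  if μ = q.unpair.1.unpair.1 then q.unpair.1.unpair.2 else q.unpair.2.unpair.1

theorem exists_sched {μ μ' : ℕ} (h : μ ≠ μ') (p p' Q : ℕ) :
    ∃ q, Q ≤ q ∧ sched q μ = p ∧ sched q μ' = p' := by
  refine ⟨Nat.pair (Nat.pair μ p) (Nat.pair p' Q), ?_, ?_, ?_⟩
  · exact (Nat.right_le_pair _ _).trans (Nat.right_le_pair _ _)
  · simp [sched]
  · simp [sched, h.symm]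

/-- A node of the forest: the level `c` and index `r` of its root, its depth `d`, its left
endpoint `x`. -/
structure Node where
  c : ℕ
  r : ℕ
  d : ℕ
  x : ℝ

/-- The level following that of a node, in its tree. -/
def Node.next (P : Node) : ℕ := Equiv.swap 0 P.c (P.d + 1)

/-- The root with index `k` at level `μ`. -/
def rootNode (k μ : ℕ) : Node := ⟨μ, k, 0, 4 * (Nat.pair μ k : ℕ)⟩

/-- The `k`-th interval of level `μ`: a child of the interval that the schedule names for the block
of `k`, if that is admissible, and a root otherwise. -/
noncomputable def node (k μ : ℕ) : Node :=
  let q := Nat.log 16 k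
  let p := (sched q μ).unpair
  if _ : p.2 < k then
    let P := node p.2 p.1
    -- The `8 * 16 ^ q` children end before `16 ^ (q + 1)`, so the logarithm recovers the block.
    if 16 ^ q ≤ k ∧ k < 16 ^ q + 2 ^ (4 * q + 3) ∧ kap p.1 p.2 < 16 ^ q ∧ μ + 2 < 16 ^ q ∧
        P.next = μ then
      ⟨P.c, P.r, P.d + 1, P.x + len p.1 p.2 * off (4 * q + 3) (k - 16 ^ q)⟩
    else rootNode k μ
  else rootNode k μ
termination_by k

/-- In block `q` of level `μ` lie the children of the `k₀`-th interval of level `ν`. -/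
structure IsParent (μ q ν k₀ : ℕ) : Prop where
  sched_eq : sched q μ = Nat.pair ν k₀
  kap_lt : kap ν k₀ < 16 ^ q
  level_lt : μ + 2 < 16 ^ q
  next_eq : (node k₀ ν).next = μ

theorem le_kap (μ k : ℕ) : k ≤ kap μ k := le_max_left _ _

theorem two_pow_block (q : ℕ) : 2 ^ (4 * q + 3) = 8 * 16 ^ q := by
  rw [pow_add, pow_mul]; norm_num; ring

theorem log_block {q e : ℕ} (he : e < 2 ^ (4 * q + 3)) : Nat.log 16 (16 ^ q + e) = q := by
  rw [two_pow_block] at he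
  apply Nat.log_eq_of_pow_le_of_lt_pow
  · omega
  · rw [pow_succ]; omega

theorem node_child {μ q ν k₀ e : ℕ} (h : IsParent μ q ν k₀) (he : e < 2 ^ (4 * q + 3)) :
    node (16 ^ q + e) μ = ⟨(node k₀ ν).c, (node k₀ ν).r, (node k₀ ν).d + 1,
      (node k₀ ν).x + len ν k₀ * off (4 * q + 3) e⟩ := by
  have h1 := h.kap_lt
  have h2 := le_kap ν k₀
  rw [node]
  simp only [log_block he, h.sched_eq, Nat.unpair_pair, Nat.add_sub_cancel_left]
  rw [dif_pos (by omega), if_pos ⟨by omega, by omega, h1, h.level_lt, h.next_eq⟩]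

theorem node_cases (μ k : ℕ) : node k μ = rootNode k μ ∨
    ∃ q ν k₀ e, IsParent μ q ν k₀ ∧ e < 2 ^ (4 * q + 3) ∧ k = 16 ^ q + e := by
  by_cases h : node k μ = rootNode k μ
  · exact Or.inl h
  right
  rw [node] at h
  simp only at h
  split_ifs at h with h1 h2
  · obtain ⟨a, b, c, d, e⟩ := h2
    refine ⟨Nat.log 16 k, (sched (Nat.log 16 k) μ).unpair.1, (sched (Nat.log 16 k) μ).unpair.2,
      k - 16 ^ Nat.log 16 k, ⟨by simp, c, d, e⟩, by omega, by omega⟩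
  · exact absurd rfl h
  · exact absurd rfl h

theorem node_eq_root {μ k : ℕ} (h : k ≤ μ + 2) : node k μ = rootNode k μ := by
  rcases node_cases μ k with h1 | ⟨q, ν, k₀, e, hp, he, rfl⟩
  · exact h1
  · have := hp.level_lt
    omega

/-- The `k`-th interval of level `μ`. -/
noncomputable def Iv (μ k : ℕ) : Set ℝ := Set.Icc (node k μ).x ((node k μ).x + len μ k)

theorem child_index_lt {μ q ν k₀ : ℕ} (h : IsParent μ q ν k₀) (e : ℕ) : kap ν k₀ < 16 ^ q + e :=
  h.kap_lt.trans_le (Nat.le_add_right _ _)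

theorem len_child_le {μ ν k k₀ : ℕ} (h : kap ν k₀ < k) : len μ k ≤ len ν k₀ / 2 := by
  have h1 := mul_del_lt_len h
  have h2 := len_le_del μ k
  have h3 : (1 : ℝ) ≤ 4 ^ (k + 2) := one_le_pow₀ (by norm_num)
  nlinarith [del_pos k]

theorem child_x_mem {ν k₀ L e : ℕ} :
    0 ≤ len ν k₀ * off L e ∧ len ν k₀ * off L e ≤ len ν k₀ / 2 := by
  obtain ⟨h0, h1⟩ := off_mem L e
  have := len_pos ν k₀
  constructor <;> nlinarith

theorem Iv_child_subset {μ q ν k₀ e : ℕ} (h : IsParent μ q ν k₀) (he : e < 2 ^ (4 * q + 3)) :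
    Iv μ (16 ^ q + e) ⊆ Iv ν k₀ := by
  have h1 := len_child_le (μ := μ) (child_index_lt h e)
  obtain ⟨h2, h3⟩ := child_x_mem (ν := ν) (k₀ := k₀) (L := 4 * q + 3) (e := e)
  unfold Iv
  rw [node_child h he]
  apply Set.Icc_subset_Icc <;> dsimp only <;> linarith

/-- Depth and level correspond by a permutation, so an infinite branch meets every level, and root
and level determine depth. -/
theorem node_level (μ k : ℕ) : Equiv.swap 0 (node k μ).c (node k μ).d = μ := by
  rcases node_cases μ k with h | ⟨q, ν, k₀, e, h, he, rfl⟩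
  · rw [h]; simp [rootNode]
  · rw [node_child h he]; exact h.next_eq

/-- Every interval lies in the interval of its root, hence within distance `1` of its position. -/
theorem node_x_mem (μ k : ℕ) :
    (4 * (Nat.pair (node k μ).c (node k μ).r : ℕ) : ℝ) ≤ (node k μ).x ∧
      (node k μ).x + len μ k ≤ 4 * (Nat.pair (node k μ).c (node k μ).r : ℕ) + 1 := by
  induction k using Nat.strong_induction_on generalizing μ with
  | _ k ih =>
    rcases node_cases μ k with h | ⟨q, ν, k₀, e, h, he, rfl⟩
    · rw [h]
      have := (len_le_del μ k).trans (del_le_half k)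
      simp only [rootNode]
      constructor <;> linarith
    · obtain ⟨i1, i2⟩ := ih k₀ ((le_kap ν k₀).trans_lt (child_index_lt h e)) ν
      have h1 := len_child_le (μ := μ) (child_index_lt h e)
      obtain ⟨h2, h3⟩ := child_x_mem (ν := ν) (k₀ := k₀) (L := 4 * q + 3) (e := e)
      rw [node_child h he]
      dsimp only
      constructor <;> linarith

/-! ### Separation within a level -/

theorem far_of_root_ne {μ k μ' k' : ℕ}
    (h : Nat.pair (node k μ).c (node k μ).r ≠ Nat.pair (node k' μ').c (node k' μ').r) :
    3 ≤ |(node k μ).x - (node k' μ').x| := by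
  obtain ⟨a1, a2⟩ := node_x_mem μ k
  obtain ⟨b1, b2⟩ := node_x_mem μ' k'
  have := len_pos μ k
  have := len_pos μ' k'
  rcases lt_or_gt_of_ne h with h | h
  · have h' : ((Nat.pair (node k μ).c (node k μ).r : ℕ) : ℝ) + 1 ≤
        (Nat.pair (node k' μ').c (node k' μ').r : ℕ) := by exact_mod_cast h
    rw [abs_sub_comm]
    refine le_trans ?_ (le_abs_self _)
    linarith
  · have h' : ((Nat.pair (node k' μ').c (node k' μ').r : ℕ) : ℝ) + 1 ≤
        (Nat.pair (node k μ).c (node k μ).r : ℕ) := by exact_mod_cast h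
    refine le_trans ?_ (le_abs_self _)
    linarith

/-- Intervals of a block that are close to each other have congruent indices. -/
theorem mod_eq_of_close {μ q ν k₀ e e' l : ℕ} (h : IsParent μ q ν k₀)
    (he : e < 2 ^ (4 * q + 3)) (he' : e' < 2 ^ (4 * q + 3)) (hl : kap ν k₀ < l)
    (hc : |(node (16 ^ q + e) μ).x - (node (16 ^ q + e') μ).x| ≤ 3 * del l) :
    e % 2 ^ min (l + 3) (4 * q + 3) = e' % 2 ^ min (l + 3) (4 * q + 3) := by
  apply mod_eq_of_abs_off_sub_lt (4 * q + 3) (l + 2)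
  rw [node_child h he, node_child h he'] at hc
  dsimp only at hc
  rw [add_sub_add_left_eq_sub, ← mul_sub, abs_mul, abs_of_pos (len_pos ν k₀)] at hc
  have h1 := mul_del_lt_len hl
  have h2 := len_pos ν k₀
  rw [lt_div_iff₀ (by positivity)]
  by_contra hcon
  push Not at hcon
  have h4 : len ν k₀ ≤ len ν k₀ * |off (4 * q + 3) e - off (4 * q + 3) e'| * (8 * 4 ^ (l + 2)) := by
    nlinarith
  have h5 : len ν k₀ * |off (4 * q + 3) e - off (4 * q + 3) e'| * (8 * 4 ^ (l + 2)) ≤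
      3 * del l * (8 * 4 ^ (l + 2)) := mul_le_mul_of_nonneg_right hc (by positivity)
  linarith

theorem le_sixteen_pow (q : ℕ) : 4 * q + 3 ≤ 16 ^ q + 2 := by
  induction q with
  | zero => simp
  | succ q ih =>
    have : 1 ≤ 16 ^ q := Nat.one_le_pow _ _ (by norm_num)
    rw [pow_succ]; omega

theorem eq_of_close {μ q ν k₀ e e' : ℕ} (h : IsParent μ q ν k₀)
    (he : e < 2 ^ (4 * q + 3)) (he' : e' < 2 ^ (4 * q + 3))
    (hc : |(node (16 ^ q + e) μ).x - (node (16 ^ q + e') μ).x| ≤ 3 * del (16 ^ q)) : e = e' := by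
  have := mod_eq_of_close h he he' h.kap_lt hc
  rwa [min_eq_right ((le_sixteen_pow q).trans (Nat.le_succ _)), Nat.mod_eq_of_lt he, Nat.mod_eq_of_lt he'] at this

theorem separated_of_block_lt {μ q q' ν k₀ e e' : ℕ} (h : IsParent μ q ν k₀)
    (h' : IsParent μ q' ν k₀) (he : e < 2 ^ (4 * q + 3)) (he' : e' < 2 ^ (4 * q' + 3))
    (hq : q < q') :
    3 * del (16 ^ q) < |(node (16 ^ q + e) μ).x - (node (16 ^ q' + e') μ).x| := by
  rw [node_child h he, node_child h' he']
  dsimp only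
  rw [add_sub_add_left_eq_sub, ← mul_sub, abs_mul, abs_of_pos (len_pos ν k₀)]
  have h1 := mul_del_lt_len h.kap_lt
  have h2 := le_abs_off_sub (show 4 * q + 3 < 4 * q' + 3 by omega) e e'
  have h3 : (4 : ℝ) ^ (4 * q + 3) ≤ 4 ^ (16 ^ q + 2) :=
    pow_le_pow_right₀ (by norm_num) (le_sixteen_pow q)
  rw [div_le_iff₀ (by positivity)] at h2
  set A := |off (4 * q + 3) e - off (4 * q' + 3) e'| with hA
  set B : ℝ := 4 ^ (16 ^ q + 2) with hB
  have hB0 : 0 < B := by positivity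
  have hA0 : 0 ≤ A := abs_nonneg _
  have h4 : 1 ≤ A * (8 * B) := h2.trans (mul_le_mul_of_nonneg_left (by linarith) hA0)
  have hApos : 0 < A := by
    by_contra hcon
    have : A = 0 := le_antisymm (not_lt.mp hcon) hA0
    rw [this] at h4; linarith
  have h5 := mul_lt_mul_of_pos_right h1 hApos
  have h6 : 3 * del (16 ^ q) * 1 ≤ 3 * del (16 ^ q) * (A * (8 * B)) :=
    mul_le_mul_of_nonneg_left h4 (by have := del_pos (16 ^ q); linarith)
  linarith

theorem node_eq_root_of_depth {μ k : ℕ} (h : (node k μ).d = 0) : node k μ = rootNode k μ := by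
  rcases node_cases μ k with h1 | ⟨q, ν, k₀, e, hp, he, rfl⟩
  · exact h1
  · rw [node_child hp he] at h
    simp at h

/-- Two intervals of one level never meet a common set of diameter `del (min k k')`. -/
theorem separated {μ k k' : ℕ} (hk : k ≠ k') :
    3 * del (min k k') < |(node k μ).x - (node k' μ).x| := by
  induction k using Nat.strong_induction_on generalizing μ k' with
  | _ k ih =>
    by_cases hr : Nat.pair (node k μ).c (node k μ).r = Nat.pair (node k' μ).c (node k' μ).r
    swap
    · have := far_of_root_ne hr
      linarith [del_le_half (min k k')]
    obtain ⟨hc, hr⟩ := Nat.pair_eq_pair.mp hr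
    have hd : (node k μ).d = (node k' μ).d := by
      have h1 := node_level μ k
      have h2 := node_level μ k'
      rw [← hc] at h2
      exact (Equiv.swap 0 (node k μ).c).injective (h1.trans h2.symm)
    by_cases h0 : (node k μ).d = 0
    · rw [node_eq_root_of_depth h0, node_eq_root_of_depth (hd ▸ h0)] at hr
      exact absurd hr hk
    rcases node_cases μ k with h | ⟨q, ν, k₀, e, h, he, rfl⟩
    · rw [h] at h0; exact absurd rfl h0
    rcases node_cases μ k' with h' | ⟨q', ν', k₀', e', h', he', rfl⟩
    · rw [hd, h'] at h0; exact absurd rfl h0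
    have hν : ν = ν' := by
      rw [node_child h he, node_child h' he'] at hc hd
      simp only [Nat.add_right_cancel_iff] at hc hd
      rw [← node_level ν k₀, ← node_level ν' k₀', hc, hd]
    subst hν
    by_cases h00 : k₀ = k₀'
    · subst h00
      rcases lt_trichotomy q q' with hq | rfl | hq
      · refine lt_of_le_of_lt ?_ (separated_of_block_lt h h' he he' hq)
        have : 16 ^ q + 2 ^ (4 * q + 3) ≤ 16 ^ q' := by
          have : 16 ^ (q + 1) ≤ 16 ^ q' := Nat.pow_le_pow_right (by norm_num) hq
          rw [two_pow_block]; rw [pow_succ] at this; omega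
        have := del_anti (show 16 ^ q ≤ min (16 ^ q + e) (16 ^ q' + e') by omega)
        linarith
      · by_contra hcon
        push Not at hcon
        refine hk (congrArg _ (eq_of_close h he he' (hcon.trans ?_)))
        have := del_anti (show 16 ^ q ≤ min (16 ^ q + e) (16 ^ q + e') by omega)
        linarith
      · rw [abs_sub_comm]
        refine lt_of_le_of_lt ?_ (separated_of_block_lt h' h he' he hq)
        have : 16 ^ q' + 2 ^ (4 * q' + 3) ≤ 16 ^ q := by
          have : 16 ^ (q' + 1) ≤ 16 ^ q := Nat.pow_le_pow_right (by norm_num) hq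
          rw [two_pow_block]; rw [pow_succ] at this; omega
        have := del_anti (show 16 ^ q' ≤ min (16 ^ q + e) (16 ^ q' + e') by omega)
        linarith
    -- Distinct parents: each offset is at most half of `del (min k₀ k₀')`, and the required bound
    -- has at least halved.
    · have hlt := (le_kap ν k₀).trans_lt (child_index_lt h e)
      have hlt' := (le_kap ν k₀').trans_lt (child_index_lt h' e')
      have h1 := ih k₀ hlt (μ := ν) h00
      have h2 := (del_anti (show min k₀ k₀' + 1 ≤ min (16 ^ q + e) (16 ^ q' + e') by omega)).trans
        (del_succ_le _)
      rw [node_child h he, node_child h' he']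
      dsimp only
      obtain ⟨a1, a2⟩ := child_x_mem (ν := ν) (k₀ := k₀) (L := 4 * q + 3) (e := e)
      obtain ⟨b1, b2⟩ := child_x_mem (ν := ν) (k₀ := k₀') (L := 4 * q' + 3) (e := e')
      have c1 := (len_le_del ν k₀).trans (del_anti (min_le_left k₀ k₀'))
      have c2 := (len_le_del ν k₀').trans (del_anti (min_le_right k₀ k₀'))
      have hpos := del_pos (min k₀ k₀')
      rcases le_total 0 ((node k₀ ν).x - (node k₀' ν).x) with hs | hs
      · rw [abs_of_nonneg hs] at h1
        refine lt_of_lt_of_le ?_ (le_abs_self _)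
        linarith
      · rw [abs_of_nonpos hs] at h1
        refine lt_of_lt_of_le ?_ (neg_le_abs _)
        linarith

/-! ### The set, and covers with a wasted member -/

/-- A picoscopic set that has no point to spare. -/
noncomputable def picoSet : Set ℝ := ⋂ μ, ⋃ k, Iv μ k

theorem isPicoscopic_picoSet : IsPicoscopic picoSet := by
  intro ε hε
  obtain ⟨n, hn⟩ := exists_pow_lt_of_lt_one hε.1 (show (1 / 2 : ℝ) < 1 by norm_num)
  refine ⟨Iv n, fun k => Set.ordConnected_Icc, Set.iInter_subset _ n, fun k => ?_⟩
  unfold Iv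
  rw [Real.volume_Icc, add_sub_cancel_left]
  apply ENNReal.ofReal_le_ofReal
  have h1 : (1 / 2 : ℝ) ^ (n + 1) ≤ ε := (half_pow_anti (Nat.le_succ n)).trans hn.le
  calc len n k = ((1 / 2 : ℝ) ^ (n + 1)) ^ (kap n k + 1).factorial := by rw [len, pow_mul]
    _ ≤ ε ^ (kap n k + 1).factorial := pow_le_pow_left₀ (by positivity) h1 _
    _ ≤ ε ^ (k + 1).factorial := pow_le_pow_of_le_one hε.1.le hε.2.le
        (Nat.factorial_le (Nat.succ_le_succ (le_kap n k)))

/-- Each `J l` has diameter at most `del l`. -/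
def IsFine (J : ℕ → Set ℝ) : Prop := ∀ l, ∀ x ∈ J l, ∀ y ∈ J l, |x - y| ≤ del l

def Hits (J : ℕ → Set ℝ) (l μ k : ℕ) : Prop := (J l ∩ Iv μ k).Nonempty

/-- The sets of `J` too long for the `k`-th interval of level `μ` miss it. -/
def Unhit (J : ℕ → Set ℝ) (μ k : ℕ) : Prop := ∀ l ≤ kap μ k, ¬ Hits J l μ k

theorem Hits.mono {J : ℕ → Set ℝ} {l μ k μ' k' : ℕ} (h : Hits J l μ k)
    (hs : Iv μ k ⊆ Iv μ' k') : Hits J l μ' k' :=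
  Set.Nonempty.mono (Set.inter_subset_inter_right _ hs) h

theorem Hits.close {J : ℕ → Set ℝ} (hJ : IsFine J) {l μ k μ' k' : ℕ} (h : Hits J l μ k)
    (h' : Hits J l μ' k') :
    |(node k μ).x - (node k' μ').x| ≤ del l + len μ k + len μ' k' := by
  obtain ⟨a, ha, ha1, ha2⟩ := h
  obtain ⟨b, hb, hb1, hb2⟩ := h'
  have h1 := abs_le.mp (hJ l a ha b hb)
  have := len_pos μ k
  have := len_pos μ' k'
  rw [abs_le]
  constructor <;> linarith [h1.1, h1.2]

theorem Hits.eq {J : ℕ → Set ℝ} (hJ : IsFine J) {l μ k k' : ℕ} (h : Hits J l μ k)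
    (h' : Hits J l μ k') (hl : min k k' ≤ l) : k = k' := by
  by_contra hne
  have h1 := h.close hJ h'
  have h2 := separated (μ := μ) hne
  have h3 := del_anti hl
  have h4 := (len_le_del μ k).trans (del_anti (min_le_left k k'))
  have h5 := (len_le_del μ k').trans (del_anti (min_le_right k k'))
  linarith

/-- Such an interval is a root, hence far from the rest of its level, so no bound on `l` is needed.
-/
theorem Hits.eq_of_root {J : ℕ → Set ℝ} (hJ : IsFine J) {l μ k k' : ℕ} (h : Hits J l μ k)
    (h' : Hits J l μ k') (hk : k ≤ μ + 2) : k = k' := by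
  have h1 := h.close hJ h'
  have h4 := (len_le_del μ k).trans (del_le_half k)
  have h5 := (len_le_del μ k').trans (del_le_half k')
  have h6 := del_le_half l
  by_contra hne
  have hr : Nat.pair (node k μ).c (node k μ).r = Nat.pair (node k' μ).c (node k' μ).r := by
    by_contra hr
    have := far_of_root_ne hr
    linarith
  obtain ⟨hc, hr⟩ := Nat.pair_eq_pair.mp hr
  have l1 := node_level μ k
  have l2 := node_level μ k'
  rw [← hc] at l2
  have hd := (Equiv.swap 0 (node k μ).c).injective (l2.trans l1.symm)
  have e1 := node_eq_root (μ := μ) hk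
  have hd0 : (node k μ).d = 0 := by rw [e1]; rfl
  have e2 := node_eq_root_of_depth (μ := μ) (k := k') (hd.trans hd0)
  rw [e1, e2] at hr
  exact hne hr

/-- If some `J j` is wasted, then every level has an unhit interval. -/
theorem exists_unhit {J : ℕ → Set ℝ} (hJ : IsFine J) {j : ℕ} (hj : ∀ μ k, ¬ Hits J j μ k)
    (μ : ℕ) : ∃ k, Unhit J μ k := by
  by_contra hcon
  simp only [Unhit] at hcon
  push Not at hcon
  choose h hle hhit using hcon
  -- An injection of the first `μ + 3` indices into themselves is onto.
  have small : ∀ l ≤ μ + 2, ∃ k ≤ μ + 2, Hits J l μ k := by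
    have hmaps : Set.MapsTo h (Finset.range (μ + 3)) (Finset.range (μ + 3)) := by
      intro k hk
      have hk' : k < μ + 3 := by simpa using hk
      have := hle k
      rw [kap, max_eq_right (by omega)] at this
      simp only [Finset.coe_range, Set.mem_Iio]
      omega
    have hinj : Set.InjOn h (Finset.range (μ + 3)) := by
      intro k hk k' _ heq
      have hk' : k < μ + 3 := by simpa using hk
      exact (hhit k).eq_of_root hJ (heq ▸ hhit k') (by omega)
    intro l hl
    obtain ⟨k, hk, rfl⟩ := Finset.surjOn_of_injOn_of_card_le h hmaps hinj le_rfl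
      (show l ∈ (Finset.range (μ + 3) : Set ℕ) by simp; omega)
    have hk' : k < μ + 3 := by simpa using hk
    exact ⟨k, by omega, hhit k⟩
  -- If `h l < l`, the set `J (h l)` is already spent on another interval; so `h l = l`.
  have large : ∀ l, μ + 2 < l → Hits J l μ l := by
    intro l
    induction l using Nat.strong_induction_on with
    | _ l ih =>
      intro hl
      have h1 := hle l
      rw [kap, max_eq_left hl.le] at h1
      rcases h1.eq_or_lt with h2 | h2
      · have := hhit l; rwa [h2] at this
      · exfalso
        rcases le_or_gt (h l) (μ + 2) with h3 | h3
        · obtain ⟨k, hk, hk'⟩ := small _ h3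
          have := hk'.eq_of_root hJ (hhit l) hk
          omega
        · have := (ih _ h2 h3).eq hJ (hhit l) (min_le_left _ _)
          omega
  rcases le_or_gt j (μ + 2) with h3 | h3
  · obtain ⟨k, _, hk⟩ := small j h3
    exact hj _ _ hk
  · exact hj _ _ (large j h3)

/-! ### Counting in a block -/

open Classical in
/-- The indices of the `q`-th block whose `J` hits some interval of that block at level `μ`. -/
noncomputable def busy (J : ℕ → Set ℝ) (μ q : ℕ) : Finset ℕ :=
  (Finset.range (2 ^ (4 * q + 3))).filter fun f =>
    ∃ e < 2 ^ (4 * q + 3), Hits J (16 ^ q + f) μ (16 ^ q + e)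

/-- A geometric series followed by ones; the extra summand on the left is its remainder, which makes
the induction telescope. -/
theorem sum_two_pow_sub_min {L : ℕ} (hL : 2 ≤ L) (n : ℕ) :
    ∑ l ∈ Finset.range n, 2 ^ (L - min (l + 3) L) + 2 ^ (L - min (n + 2) L) ≤ 2 ^ (L - 2) + n := by
  induction n with
  | zero => simp [min_eq_left hL]
  | succ n ih =>
    rw [Finset.sum_range_succ]
    rcases le_or_gt (n + 3) L with h | h
    · rw [min_eq_left (by omega), show L - (n + 2) = (L - (n + 3)) + 1 by omega, pow_succ] at ih
      rw [min_eq_left h, show n + 1 + 2 = n + 3 by ring]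
      omega
    · rw [min_eq_right (by omega)] at ih
      rw [show n + 1 + 2 = n + 3 by ring, min_eq_right (by omega)]
      simp only [Nat.sub_self, pow_zero] at ih ⊢
      omega

/-- In a block that is at most half busy some child is unhit. -/
theorem exists_unhit_child {J : ℕ → Set ℝ} (hJ : IsFine J) {μ q ν k₀ : ℕ}
    (h : IsParent μ q ν k₀) (hN : Unhit J ν k₀) (hb : 2 * (busy J μ q).card ≤ 2 ^ (4 * q + 3)) :
    ∃ e < 2 ^ (4 * q + 3), Unhit J μ (16 ^ q + e) := by
  classical
  by_contra hcon
  push Not at hcon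
  set H : ℕ → Finset ℕ := fun l =>
    (Finset.range (2 ^ (4 * q + 3))).filter fun e => Hits J l μ (16 ^ q + e) with hH
  have hmem : ∀ l e, e ∈ H l ↔ e < 2 ^ (4 * q + 3) ∧ Hits J l μ (16 ^ q + e) := by
    intro l e; simp [hH]
  have hclose : ∀ l m, m ≤ l → m ≤ 16 ^ q → ∀ e ∈ H l, ∀ e' ∈ H l,
      |(node (16 ^ q + e) μ).x - (node (16 ^ q + e') μ).x| ≤ 3 * del m := by
    intro l m hm hm' e he e' he'
    have h1 := ((hmem l e).mp he).2.close hJ ((hmem l e').mp he').2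
    have h2 := (len_le_del μ (16 ^ q + e)).trans (del_anti (hm'.trans (Nat.le_add_right _ e)))
    have h3 := (len_le_del μ (16 ^ q + e')).trans (del_anti (hm'.trans (Nat.le_add_right _ e')))
    have h4 := del_anti hm
    linarith
  have hsmall : ∀ l < 16 ^ q,
      (H l).card ≤ 2 ^ (4 * q + 3 - min (l + 3) (4 * q + 3)) := by
    intro l hl
    rcases le_or_gt l (kap ν k₀) with h1 | h1
    · have : H l = ∅ := by
        apply Finset.eq_empty_of_forall_notMem
        intro e he
        obtain ⟨he1, he2⟩ := (hmem l e).mp he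
        exact hN l h1 (he2.mono (Iv_child_subset h he1))
      simp [this]
    · refine card_le_of_mod_eq (min_le_right _ _) _ (fun e he => ((hmem l e).mp he).1) ?_
      intro e he e' he'
      exact mod_eq_of_close h ((hmem l e).mp he).1 ((hmem l e').mp he').1 h1
        (hclose l l le_rfl hl.le e he e' he')
  have hlarge : ∀ l, 16 ^ q ≤ l → (H l).card ≤ 1 := by
    intro l hl
    rw [Finset.card_le_one]
    intro e he e' he'
    exact eq_of_close h ((hmem l e).mp he).1 ((hmem l e').mp he').1
      (hclose l (16 ^ q) hl le_rfl e he e' he')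
  have hcover : Finset.range (2 ^ (4 * q + 3)) ⊆
      (Finset.range (16 ^ q)).biUnion H ∪ (busy J μ q).biUnion fun f => H (16 ^ q + f) := by
    intro e he
    have he' := Finset.mem_range.mp he
    have h1 := hcon e he'
    simp only [Unhit] at h1
    push Not at h1
    obtain ⟨l, hl, hhit⟩ := h1
    have hlev := h.level_lt
    rw [kap, max_eq_left (by omega)] at hl
    rw [Finset.mem_union, Finset.mem_biUnion, Finset.mem_biUnion]
    rcases lt_or_ge l (16 ^ q) with h2 | h2
    · exact Or.inl ⟨l, Finset.mem_range.mpr h2, (hmem l e).mpr ⟨he', hhit⟩⟩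
    · obtain ⟨f, rfl⟩ := Nat.exists_eq_add_of_le h2
      refine Or.inr ⟨f, ?_, (hmem _ e).mpr ⟨he', hhit⟩⟩
      simp only [busy, Finset.mem_filter, Finset.mem_range]
      exact ⟨by omega, e, he', hhit⟩
  -- With `N = 16 ^ q`: sets of index below `N` hit fewer than `2N + N` children and busy ones at
  -- most `4N`, out of `8N`.
  have hcard := (Finset.card_le_card hcover).trans (Finset.card_union_le _ _)
  rw [Finset.card_range] at hcard
  have h1 : ((Finset.range (16 ^ q)).biUnion H).card ≤
      ∑ l ∈ Finset.range (16 ^ q), 2 ^ (4 * q + 3 - min (l + 3) (4 * q + 3)) :=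
    Finset.card_biUnion_le.trans
      (Finset.sum_le_sum fun l hl => hsmall l (Finset.mem_range.mp hl))
  have h2 : ((busy J μ q).biUnion fun f => H (16 ^ q + f)).card ≤ (busy J μ q).card * 1 :=
    Finset.card_biUnion_le_card_mul _ _ _ fun f _ => hlarge _ (Nat.le_add_right _ _)
  have h3 := sum_two_pow_sub_min (show 2 ≤ 4 * q + 3 by omega) (16 ^ q)
  have h4 : 2 ^ (4 * q + 3 - 2) = 2 * 16 ^ q := by
    rw [show 4 * q + 3 - 2 = 4 * q + 1 by omega, pow_add, pow_mul]; norm_num; ring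
  have h5 : 0 < 2 ^ (4 * q + 3 - min (16 ^ q + 2) (4 * q + 3)) := by positivity
  rw [two_pow_block] at hcard hb
  rw [h4] at h3
  omega

/-! ### Filled intervals and the contradiction -/

/-- Almost all blocks of children are more than half busy. -/
def Filled (J : ℕ → Set ℝ) (ν k : ℕ) : Prop :=
  ∃ Q, ∀ q ≥ Q, IsParent (node k ν).next q ν k →
    2 ^ (4 * q + 3) < 2 * (busy J (node k ν).next q).card

theorem Iv_subset_level (μ k d : ℕ) (hd : d ≤ (node k μ).d) :
    ∃ k', Iv μ k ⊆ Iv (Equiv.swap 0 (node k μ).c d) k' := by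
  induction k using Nat.strong_induction_on generalizing μ with
  | _ k ih =>
    rcases hd.eq_or_lt with rfl | hlt
    · exact ⟨k, by rw [node_level]⟩
    rcases node_cases μ k with h | ⟨q, ν, k₀, e, h, he, rfl⟩
    · rw [h] at hlt; exact absurd hlt (Nat.not_lt_zero _)
    · rw [node_child h he] at hlt ⊢
      obtain ⟨k', hk'⟩ := ih k₀ ((le_kap ν k₀).trans_lt (child_index_lt h e)) ν
        (Nat.le_of_lt_succ hlt)
      exact ⟨k', (Iv_child_subset h he).trans hk'⟩

theorem exists_filled {J : ℕ → Set ℝ} (hJ : IsFine J) (hcov : picoSet ⊆ ⋃ l, J l) {ν k : ℕ}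
    (h : Unhit J ν k) :
    ∃ ν' k', Iv ν' k' ⊆ Iv ν k ∧ (node k' ν').next ≠ ν ∧ Filled J ν' k' := by
  by_contra hcon
  push Not at hcon
  let S := {p : ℕ × ℕ // Unhit J p.1 p.2 ∧ Iv p.1 p.2 ⊆ Iv ν k ∧
    (node p.2 p.1).c = (node k ν).c ∧ (node k ν).d ≤ (node p.2 p.1).d}
  have step : ∀ p : S, ∃ p' : S, Iv p'.1.1 p'.1.2 ⊆ Iv p.1.1 p.1.2 ∧
      (node p'.1.2 p'.1.1).d = (node p.1.2 p.1.1).d + 1 ∧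
      kap p.1.1 p.1.2 < kap p'.1.1 p'.1.2 := by
    rintro ⟨⟨ν', k'⟩, hun, hsub, hc, hd⟩
    dsimp only at hun hsub hc hd ⊢
    -- The next level is not `ν`, since its depth exceeds that of the starting interval.
    have hnf := hcon ν' k' hsub (by
      intro heq
      rw [Node.next, ← node_level ν k, hc] at heq
      have := (Equiv.swap 0 (node k ν).c).injective heq
      omega)
    simp only [Filled] at hnf
    push Not at hnf
    obtain ⟨q, -, hpar, hbusy⟩ := hnf 0
    obtain ⟨e, he, hunc⟩ := exists_unhit_child hJ hpar hun hbusy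
    have hsubc := Iv_child_subset hpar he
    refine ⟨⟨⟨(node k' ν').next, 16 ^ q + e⟩, hunc, hsubc.trans hsub, ?_, ?_⟩, hsubc, ?_, ?_⟩
    · rw [node_child hpar he]; exact hc
    · rw [node_child hpar he]; exact hd.trans (Nat.le_succ _)
    · rw [node_child hpar he]
    · exact (child_index_lt hpar e).trans_le (le_kap _ _)
  choose next hnsub hnd hnk using step
  let s : ℕ → S := fun n => next^[n] ⟨(ν, k), h, subset_rfl, rfl, le_rfl⟩
  have hs : ∀ n, s (n + 1) = next (s n) := fun n => Function.iterate_succ_apply' next n _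
  have hdep : ∀ n, (node (s n).1.2 (s n).1.1).d = (node k ν).d + n := by
    intro n
    induction n with
    | zero => rfl
    | succ n ih => rw [hs, hnd, ih]; ring
  have hkap : ∀ n, n ≤ kap (s n).1.1 (s n).1.2 := by
    intro n
    induction n with
    | zero => exact Nat.zero_le _
    | succ n ih => rw [hs]; exact ih.trans_lt (hnk _)
  obtain ⟨x, hx⟩ := IsCompact.nonempty_iInter_of_sequence_nonempty_isCompact_isClosed
    (fun n => Iv (s n).1.1 (s n).1.2) (fun n => by rw [hs]; exact hnsub _)
    (fun n => Set.nonempty_Icc.mpr (by have := len_pos (s n).1.1 (s n).1.2; linarith))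
    isCompact_Icc (fun n => isClosed_Icc)
  rw [Set.mem_iInter] at hx
  have hxX : x ∈ picoSet := by
    refine Set.mem_iInter.mpr fun μ => ?_
    -- Level `μ` has depth `n` in this tree, and the `n`-th member of the branch is at least that
    -- deep.
    set n := Equiv.swap 0 (node k ν).c μ with hn
    obtain ⟨k', hk'⟩ := Iv_subset_level (s n).1.1 (s n).1.2 n (by rw [hdep]; omega)
    rw [(s n).2.2.2.1, hn, Equiv.swap_apply_self] at hk'
    exact Set.mem_iUnion.mpr ⟨k', hk' (hx _)⟩
  obtain ⟨l, hl⟩ := Set.mem_iUnion.mp (hcov hxX)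
  exact (s l).2.1 l (hkap l) ⟨x, hl, hx l⟩

/-- A fine sequence of sets with a wasted member does not cover `picoSet`. -/
theorem not_subset_iUnion {J : ℕ → Set ℝ} (hJ : IsFine J) {j : ℕ} (hj : ∀ μ k, ¬ Hits J j μ k) :
    ¬ picoSet ⊆ ⋃ l, J l := by
  classical
  intro hcov
  obtain ⟨k₀, h₀⟩ := exists_unhit hJ hj 0
  obtain ⟨ν, k, -, -, Q, hQ⟩ := exists_filled hJ hcov h₀
  set μ := (node k ν).next with hμ
  obtain ⟨k₁, h₁⟩ := exists_unhit hJ hj μ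
  obtain ⟨ν', k', hsub, hne, Q', hQ'⟩ := exists_filled hJ hcov h₁
  set μ' := (node k' ν').next with hμ'
  obtain ⟨q, hq, hs, hs'⟩ := exists_sched hne.symm (Nat.pair ν k) (Nat.pair ν' k')
    (Q + Q' + kap ν k + kap ν' k' + (μ + 2) + (μ' + 2) + k₁)
  have hlt : q < 16 ^ q := Nat.lt_pow_self (by norm_num)
  have hpar : IsParent μ q ν k := ⟨hs, by omega, by omega, rfl⟩
  have hpar' : IsParent μ' q ν' k' := ⟨hs', by omega, by omega, rfl⟩
  have hb := hQ q (by omega) hpar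
  have hb' := hQ' q (by omega) hpar'
  obtain ⟨f, hf⟩ : (busy J μ q ∩ busy J μ' q).Nonempty := by
    rw [← Finset.card_pos]
    have h1 := Finset.card_union_add_card_inter (busy J μ q) (busy J μ' q)
    have h2 : (busy J μ q ∪ busy J μ' q).card ≤ 2 ^ (4 * q + 3) := by
      rw [← Finset.card_range (2 ^ (4 * q + 3))]
      exact Finset.card_le_card
        (Finset.union_subset (Finset.filter_subset _ _) (Finset.filter_subset _ _))
    omega
  simp only [busy, Finset.mem_inter, Finset.mem_filter] at hf
  obtain ⟨⟨-, e, he, hhit⟩, -, e', he', hhit'⟩ := hf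
  -- Equality of the indices `16 ^ q + e` and `k₁` is absurd, as `k₁ ≤ q < 16 ^ q`.
  have := hhit.eq hJ (hhit'.mono ((Iv_child_subset hpar' he').trans hsub)) (by omega)
  omega

/-- All intervals lie in `[0, ∞)`, so a set of diameter at most `1 / 2` containing `-10` is wasted.
-/
theorem not_isPicoscopic_union : ¬ IsPicoscopic (picoSet ∪ {-10}) := by
  intro h
  obtain ⟨I, hI, hcov, hvol⟩ := h (1 / 2) (by norm_num)
  have hfine : IsFine I := by
    intro l x hx y hy
    have h1 := (MeasureTheory.measure_mono ((hI l).uIcc_subset hy hx)).trans (hvol l)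
    rw [Real.volume_interval] at h1
    exact (ENNReal.ofReal_le_ofReal_iff (del_pos l).le).mp h1
  obtain ⟨j, hj⟩ := Set.mem_iUnion.mp (hcov (Or.inr rfl))
  refine not_subset_iUnion hfine (j := j) ?_ (Set.subset_union_left.trans hcov)
  rintro μ k ⟨a, ha, ha', -⟩
  have h1 := (abs_le.mp (hfine j a ha _ hj)).2
  have h2 := (node_x_mem μ k).1
  have h3 := del_le_half j
  have h4 : (0 : ℝ) ≤ (Nat.pair (node k μ).c (node k μ).r : ℕ) := Nat.cast_nonneg _
  linarith

end Picoscopic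

theorem mainTheorem2 :
    ∃ (X : Set ℝ) (x : ℝ), IsPicoscopic X ∧ ¬ IsPicoscopic (X ∪ {x}) :=
  ⟨Picoscopic.picoSet, -10, Picoscopic.isPicoscopic_picoSet, Picoscopic.not_isPicoscopic_union⟩
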